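/- Let $\mathbb{T}=x_1x_2x_3\cdots$ be the Tribonacci word, i.e. the fixed point beginning with $a$ of the morphism $\tau$ given by $a\mapsto ab$, $b\mapsto ac$, $c\mapsto a$. For a nonempty word $\omega$ occurring in $\mathbb{T}$ and $p\ge 1$, let $\omega_p$ be the $p$-th occurrence of $\omega$ in $\mathbb{T}$, counted from the left. For $n\ge 1$ let $b(n)$ be the number of pairs $(\omega,p)$ such that $\omega$ is a nonempty palindrome occurring in $\mathbb{T}$ and $\omega_p$ ends at position $n$, i.e. $\omega_p$ is a suffix of $x_1\cdots x_n$. Let the kernel numbers be $k_0=0$, $k_1=k_2=1$, $k_m=k_{m-1}+k_{m-2}+k_{m-3}-1$ for $m\ge 3$, and the Tribonacci numbers $t_0=1$, $t_1=2$, $t_2=4$, $t_m=t_{m-1}+t_{m-2}+t_{m-3}$ for $m\ge 3$. Then $$[b(1)]=[1],\qquad [b(2),b(3)]=[1,2],\qquad [b(4),b(5),b(6),b(7)]=[1,2,2,3],$$ and for every $m\ge 4$ $$[b(k_{m+3}-1),\dots,b(k_{m+4}-2)]=[b(k_m-1),\dots,b(k_{m+1}-2),\,b(k_{m+1}-1),\dots,b(k_{m+2}-2),\,b(k_{m+2}-1),\dots,b(k_{m+3}-2)]+[\underbrace{1,\dots,1}_{t_{m-1}}],$$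 where both vectors on the right-hand side have length $t_{m-1}$. -/

import Mathlib

namespace Tribonacci

/-- The three-letter alphabet `{a, b, c}`. -/
inductive Letter : Type
  | a : Letter
  | b : Letter
  | c : Letter
  deriving DecidableEq

/-- The Tribonacci morphism on letters: `a ↦ ab`, `b ↦ ac`, `c ↦ a`. -/
def tau : Letter → List Letter
  | Letter.a => [Letter.a, Letter.b]
  | Letter.b => [Letter.a, Letter.c]
  | Letter.c => [Letter.a]

/-- The finite words `T m = τ^m(a)`. -/
def T : ℕ → List Letter
  | 0 => [Letter.a]
  | m + 1 => (T m).flatMap tau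

/-- The Tribonacci word, i.e. the fixed point of `τ` beginning with `a`: `word i` is its letter at
position `i`, for `i ≥ 1`. It is read off from the prefix `T i`, which has more than `i` letters, so
the default value of `getD` is not used at positions `i ≥ 1` (see `T_getElem?`). -/
def word (i : ℕ) : Letter := (T i).getD (i - 1) Letter.a

/-- The factor of the given length of the Tribonacci word starting at position `i`. -/
def factorAt (i len : ℕ) : List Letter := (List.range' i len).map word

/-- The word `w` occurs in the Tribonacci word with its first letter at position `i` (`i ≥ 1`). -/
def OccursAt (w : List Letter) (i : ℕ) : Prop := 1 ≤ i ∧ factorAt i w.length = w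

/-- The `p`-th occurrence of `w` in the Tribonacci word has its first letter at position `i`:
`w` occurs there, and this is the `p`-th of its occurrences counted from the left. -/
def IsNthOccurrence (w : List Letter) (p i : ℕ) : Prop :=
  OccursAt w i ∧ {j : ℕ | j ≤ i ∧ OccursAt w j}.ncard = p

/-- The nonempty palindromes occurring in the Tribonacci word. -/
def palindromes : Set (List Letter) := {w | w ≠ [] ∧ w.Palindrome ∧ ∃ i, OccursAt w i}

/-- The pairs `(w, p)` such that `w` is a palindrome whose `p`-th occurrence in the Tribonacci word
is a suffix of the prefix of length `n`, i.e. ends at position `n`. -/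
def palindromesEndingAt (n : ℕ) : Set (List Letter × ℕ) :=
  {x | x.1 ∈ palindromes ∧ ∃ i, IsNthOccurrence x.1 x.2 i ∧ i + x.1.length = n + 1}

/-- The number of palindrome occurrences ending at position `n`
(the set is finite, see `palindromesEndingAt_finite`). -/
noncomputable def b (n : ℕ) : ℕ := (palindromesEndingAt n).ncard

/-- The Tribonacci numbers `t 0 = 1`, `t 1 = 2`, `t 2 = 4`; `t m` is the length of `T m`. -/
def t : ℕ → ℕ
  | 0 => 1
  | 1 => 2
  | 2 => 4
  | m + 3 => t (m + 2) + t (m + 1) + t m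

/-- The kernel numbers `0, 1, 1, 1, 2, 3, 5, 9, 16, …` (the subtraction never truncates). -/
def k : ℕ → ℕ
  | 0 => 0
  | 1 => 1
  | 2 => 1
  | m + 3 => k (m + 2) + k (m + 1) + k m - 1

/-- The block `[b(i), b(i+1), …, b(j)]`. -/
noncomputable def block (i j : ℕ) : List ℕ := (List.range' i (j + 1 - i)).map b

theorem T_prefix_succ (m : ℕ) : T m <+: T (m + 1) := by
  induction m with
  | zero => exact ⟨[Letter.b], rfl⟩
  | succ m ih =>
    obtain ⟨s, hs⟩ := ih
    refine ⟨s.flatMap tau, ?_⟩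
    change (T m).flatMap tau ++ s.flatMap tau = (T (m + 1)).flatMap tau
    rw [← hs, List.flatMap_append]

theorem T_prefix {m n : ℕ} (h : m ≤ n) : T m <+: T n := by
  induction n, h using Nat.le_induction with
  | base => exact List.prefix_rfl
  | succ n _ ih => exact ih.trans (T_prefix_succ n)

theorem lt_length_T (m : ℕ) : m < (T m).length := by
  have key : ∀ l : List Letter, l.length ≤ (l.flatMap tau).length := by
    intro l
    induction l with
    | nil => simp
    | cons x l ih =>
      rw [List.flatMap_cons, List.length_append, List.length_cons]
      cases x <;> simp only [tau, List.length_cons, List.length_nil] <;> omega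
  have hd : ∀ m, ∃ s, T m = Letter.a :: s := by
    intro m
    obtain ⟨s, hs⟩ := T_prefix (Nat.zero_le m)
    exact ⟨s, hs.symm⟩
  induction m with
  | zero => simp [T]
  | succ m ih =>
    obtain ⟨s, hs⟩ := hd m
    have := key s
    change m + 1 < ((T m).flatMap tau).length
    rw [hs] at ih ⊢
    rw [List.flatMap_cons, List.length_append]
    simp only [tau, List.length_cons, List.length_nil] at ih ⊢
    omega

/-- Every `T m` is a prefix of the Tribonacci word. -/
theorem T_getElem? {m i : ℕ} (h1 : 1 ≤ i) (hi : i ≤ (T m).length) :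
    (T m)[i - 1]? = some (word i) := by
  have hlt := lt_length_T i
  have e : (T i)[i - 1]? = some (word i) := by
    rw [word, List.getD_eq_getElem?_getD, List.getElem?_eq_getElem (by omega)]
    rfl
  rw [← e]
  rcases le_total m i with h | h
  · obtain ⟨s, hs⟩ := T_prefix h
    rw [← hs, List.getElem?_append_left (by omega)]
  · obtain ⟨s, hs⟩ := T_prefix h
    rw [← hs, List.getElem?_append_left (by omega)]

theorem palindromesEndingAt_finite (n : ℕ) : (palindromesEndingAt n).Finite := by
  refine Set.Finite.of_finite_image (f := fun x => x.1.length)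
    ((Set.finite_Iic (n + 1)).subset ?_) ?_
  · rintro _ ⟨x, ⟨_, i, _, h⟩, rfl⟩
    simp only [Set.mem_Iic]
    omega
  · rintro ⟨w, p⟩ ⟨_, i, ⟨hw, hp⟩, hi⟩ ⟨w', p'⟩ ⟨_, i', ⟨hw', hp'⟩, hi'⟩ h
    simp only at h hi hi' hw hw' hp hp'
    obtain rfl : i = i' := by omega
    obtain rfl : w = w' := by rw [← hw.2, ← hw'.2, h]
    rw [← hp, ← hp']

end Tribonacci

namespace Tribonacci

/-! Write U_m for `palPrefix m`. Since U_{m+1} = T_m U_m, the palindrome U_{m+1} has period t_m;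
since |U_m| = k_{m+4} - 2, the blocks of the theorem are the gaps between consecutive lengths |U_m|.
Take a palindrome ending in (|U_{m+3}|, |U_{m+4}|]. If it starts after t_{m+3}, translation by this
period matches it with a palindrome ending t_{m+3} earlier. Otherwise it covers the window [t_{m+3},
|U_{m+3}| + 1], which carries `kernelWord m`. It must then share the centre of U_{m+4}: else the two
reflections compose to a translation that puts the kernel word inside U_{m+3}, which
`not_kernelWord_infix` excludes by desubstitution. Exactly one such palindrome exists for each end,
whence the + 1 in `b_add_t`. -/

/-! ### Palindromic prefixes and kernel words -/

/-- The palindromic prefixes of the Tribonacci word, in order of length. -/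
def palPrefix : ℕ → List Letter
  | 0 => []
  | m + 1 => (palPrefix m).flatMap tau ++ [Letter.a]

/-- The cyclic permutation of the alphabet followed by the last letters of the words `T m`. -/
def nextLetter : Letter → Letter
  | Letter.a => Letter.b
  | Letter.b => Letter.c
  | Letter.c => Letter.a

/-- The last letter of `T m`. -/
def lastLetter : ℕ → Letter
  | 0 => Letter.a
  | m + 1 => nextLetter (lastLetter m)

/-- The kernel words: palindromic prefixes bordered by the letter `lastLetter m`. -/
def kernelWord (m : ℕ) : List Letter := lastLetter m :: palPrefix m ++ [lastLetter m]

/-- Each `tau x` followed by `a` is a palindrome: aba, aca, aa. -/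
theorem reverse_flatMap_tau (l : List Letter) :
    (l.flatMap tau ++ [Letter.a]).reverse = l.reverse.flatMap tau ++ [Letter.a] := by
  induction l with
  | nil => rfl
  | cons x l ih =>
    rw [List.flatMap_cons, List.append_assoc, List.reverse_append, ih, List.reverse_cons,
      List.flatMap_append]
    cases x <;> simp [tau]

theorem reverse_palPrefix (m : ℕ) : (palPrefix m).reverse = palPrefix m := by
  induction m with
  | zero => rfl
  | succ m ih => rw [palPrefix, reverse_flatMap_tau, ih]

theorem palPrefix_succ_eq_append (m : ℕ) : palPrefix (m + 1) = T m ++ palPrefix m := by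
  induction m with
  | zero => rfl
  | succ m ih =>
    rw [palPrefix, ih, List.flatMap_append, List.append_assoc, T, ← ih]
    rfl

theorem exists_flatMap_tau_append (l : List Letter) :
    ∃ r, l.flatMap tau ++ [Letter.a] = Letter.a :: r := by
  rcases l with _ | ⟨_ | _ | _, l⟩ <;> simp [tau]

theorem palPrefix_prefix_succ (m : ℕ) : palPrefix m <+: palPrefix (m + 1) := by
  induction m with
  | zero => exact List.nil_prefix
  | succ m ih =>
    obtain ⟨s, hs⟩ := ih
    obtain ⟨r, hr⟩ := exists_flatMap_tau_append s
    refine ⟨r, ?_⟩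
    rw [palPrefix, palPrefix, ← hs, List.flatMap_append, List.append_assoc, List.append_assoc, hr]
    rfl

theorem palPrefix_prefix {m n : ℕ} (h : m ≤ n) : palPrefix m <+: palPrefix n := by
  induction n, h using Nat.le_induction with
  | base => exact List.prefix_rfl
  | succ n _ ih => exact ih.trans (palPrefix_prefix_succ n)

theorem exists_palPrefix_prefix_T (m : ℕ) : ∃ n, palPrefix m <+: T n := by
  -- Both words are prefixes of one later palindromic prefix; the index makes `T` the longer one.
  refine ⟨m + (palPrefix m).length, List.prefix_of_prefix_length_le
    (palPrefix_prefix (by omega : m ≤ m + (palPrefix m).length + 1)) ?_ ?_⟩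
  · rw [palPrefix_succ_eq_append]
    exact List.prefix_append _ _
  · have := lt_length_T (m + (palPrefix m).length)
    omega

/-! ### Factors as windows of positions -/

theorem length_factorAt (i n : ℕ) : (factorAt i n).length = n := by simp [factorAt]

theorem factorAt_append (i m n : ℕ) :
    factorAt i m ++ factorAt (i + m) n = factorAt i (m + n) := by
  rw [factorAt, factorAt, factorAt, ← List.map_append, ← List.range'_append, one_mul]

theorem factorAt_congr {i j n : ℕ} (h : ∀ l < n, word (i + l) = word (j + l)) :
    factorAt i n = factorAt j n := by
  apply List.ext_getElem <;> simp [factorAt]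
  exact h

theorem word_eq_of_factorAt_eq {i j n : ℕ} (h : factorAt i n = factorAt j n) {l : ℕ} (hl : l < n) :
    word (i + l) = word (j + l) := by
  have e := congrArg (fun w => w[l]?) h
  simpa [factorAt, hl] using e

theorem eq_factorAt_of_prefix_T {w : List Letter} {n : ℕ} (h : w <+: T n) :
    w = factorAt 1 w.length := by
  apply List.ext_getElem?
  intro i
  by_cases hi : i < w.length
  · have hT := T_getElem? (m := n) (i := i + 1) (by omega) (by have := h.length_le; omega)
    obtain ⟨s, hs⟩ := h
    rw [← hs, Nat.add_sub_cancel, List.getElem?_append_left hi] at hT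
    rw [hT]
    simp [factorAt, hi, Nat.add_comm]
  · simp [factorAt, hi]

theorem palPrefix_eq_factorAt (m : ℕ) : palPrefix m = factorAt 1 (palPrefix m).length := by
  obtain ⟨n, hn⟩ := exists_palPrefix_prefix_T m
  exact eq_factorAt_of_prefix_T hn

theorem eq_factorAt_of_append {u v w : List Letter} {i : ℕ}
    (h : u ++ v ++ w = factorAt i (u ++ v ++ w).length) :
    v = factorAt (i + u.length) v.length := by
  rw [List.length_append, List.length_append, ← factorAt_append, ← factorAt_append] at h
  have h1 := List.append_inj_left h (by simp [length_factorAt])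
  exact List.append_inj_right h1 (by simp [length_factorAt])

theorem factorAt_infix {i n l : ℕ} (h1 : 1 ≤ i) (h2 : i + n ≤ l + 1) :
    factorAt i n <:+: factorAt 1 l := by
  refine ⟨factorAt 1 (i - 1), factorAt (i + n) (l + 1 - (i + n)), ?_⟩
  have e := factorAt_append 1 (i - 1) n
  rw [show 1 + (i - 1) = i by omega] at e
  rw [e]
  have e' := factorAt_append 1 (i - 1 + n) (l + 1 - (i + n))
  rw [show 1 + (i - 1 + n) = i + n by omega,
    show i - 1 + n + (l + 1 - (i + n)) = l by omega] at e'
  exact e'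

/-! ### Kernel words and desubstitution -/

/-- The kernel word `kernelWord m` begins at the last letter of the prefix `T (m + 3)`. -/
theorem exists_kernelWord_decomposition (m : ℕ) : ∃ u v, T (m + 3) = u ++ [lastLetter m] ∧
    palPrefix (m + 4) = u ++ kernelWord m ++ v := by
  induction m with
  | zero =>
    exact ⟨[Letter.a, Letter.b, Letter.a, Letter.c, Letter.a, Letter.b],
      [Letter.b, Letter.a, Letter.c, Letter.a, Letter.b, Letter.a], rfl, rfl⟩
  | succ m ih =>
    obtain ⟨u, v, hT, hU⟩ := ih
    obtain ⟨r, hr⟩ := exists_flatMap_tau_append v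
    have eT : T (m + 1 + 3) = (T (m + 3)).flatMap tau := rfl
    have eU : palPrefix (m + 1 + 4) = (palPrefix (m + 4)).flatMap tau ++ [Letter.a] := rfl
    rw [eT, eU, hT, hU]
    simp only [kernelWord, lastLetter, palPrefix]
    -- A new border b or c is the second letter of an image, so its a joins the left part. A new
    -- border a is all of `tau c`, and the a after U_{m+1} is the first letter of the image of `v`.
    cases lastLetter m
    · exact ⟨u.flatMap tau ++ [Letter.a], v.flatMap tau ++ [Letter.a], by simp [tau, nextLetter],
        by simp [tau, nextLetter]⟩
    · exact ⟨u.flatMap tau ++ [Letter.a], v.flatMap tau ++ [Letter.a], by simp [tau, nextLetter],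
        by simp [tau, nextLetter]⟩
    · exact ⟨u.flatMap tau, r, by simp [tau, nextLetter], by simp [tau, nextLetter, hr]⟩

theorem desubstitute_of_a {l p q : List Letter}
    (h : l.flatMap tau ++ [Letter.a] = p ++ Letter.a :: q) :
    ∃ l₁ l₂, l = l₁ ++ l₂ ∧ l₂.flatMap tau ++ [Letter.a] = Letter.a :: q := by
  induction l generalizing p with
  | nil =>
    rcases p with _ | ⟨x, p⟩
    · exact ⟨[], [], rfl, h⟩
    · simp at h
  | cons y l ih =>
    rcases p with _ | ⟨x, p⟩
    · exact ⟨[], y :: l, rfl, h⟩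
    · have key : ∃ p', l.flatMap tau ++ [Letter.a] = p' ++ Letter.a :: q := by
        cases y
        · rcases p with _ | ⟨x', p⟩
          · simp [tau] at h
          · exact ⟨p, by simp [tau] at h; exact h.2.2⟩
        · rcases p with _ | ⟨x', p⟩
          · simp [tau] at h
          · exact ⟨p, by simp [tau] at h; exact h.2.2⟩
        · exact ⟨p, by simp [tau] at h; exact h.2⟩
      obtain ⟨p', hp'⟩ := key
      obtain ⟨l₁, l₂, rfl, h₂⟩ := ih hp'
      exact ⟨y :: l₁, l₂, rfl, h₂⟩

/-- The letter b ends only `tau a`, and c ends only `tau b`. -/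
theorem desubstitute_of_nextLetter {x : Letter} (hx : x ≠ Letter.c) {l p q : List Letter}
    (h : l.flatMap tau ++ [Letter.a] = p ++ nextLetter x :: q) :
    ∃ l₁ l₂, l = l₁ ++ x :: l₂ ∧ l₂.flatMap tau ++ [Letter.a] = q := by
  induction l generalizing p with
  | nil => cases x <;> rcases p with _ | ⟨y, p⟩ <;> simp_all [nextLetter]
  | cons y l ih =>
    have key : (y = x ∧ l.flatMap tau ++ [Letter.a] = q) ∨
        ∃ p', l.flatMap tau ++ [Letter.a] = p' ++ nextLetter x :: q := by
      rcases p with _ | ⟨z, _ | ⟨z', p⟩⟩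
      · cases x <;> cases y <;> simp_all [tau, nextLetter]
      · cases y
        · cases x <;> simp [tau, nextLetter] at h hx ⊢
          exact Or.inl h.2
        · cases x <;> simp [tau, nextLetter] at h hx ⊢
          exact Or.inl h.2
        · exact Or.inr ⟨[], by simp [tau] at h; exact h.2⟩
      · cases y
        · exact Or.inr ⟨p, by simp [tau] at h; exact h.2.2⟩
        · exact Or.inr ⟨p, by simp [tau] at h; exact h.2.2⟩
        · exact Or.inr ⟨z' :: p, by simp [tau] at h; exact h.2⟩
    rcases key with ⟨rfl, hq⟩ | ⟨p', hp'⟩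
    · exact ⟨[], l, rfl, hq⟩
    · obtain ⟨l₁, l₂, rfl, h₂⟩ := ih hp'
      exact ⟨y :: l₁, l₂, rfl, h₂⟩

/-- Every image starts with a and has no other a, so the next a shows where it ends and decoding is
unique. -/
theorem desubstitute_prefix {u l r : List Letter}
    (h : l.flatMap tau ++ [Letter.a] = u.flatMap tau ++ Letter.a :: r) :
    ∃ l', l = u ++ l' ∧ l'.flatMap tau ++ [Letter.a] = Letter.a :: r := by
  induction u generalizing l with
  | nil => exact ⟨l, rfl, h⟩
  | cons x u ih =>
    have key : ∃ l', l = x :: l' ∧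
        l'.flatMap tau ++ [Letter.a] = u.flatMap tau ++ Letter.a :: r := by
      have hu : ∃ s, u.flatMap tau ++ Letter.a :: r = Letter.a :: s := by
        rcases u with _ | ⟨_ | _ | _, u⟩ <;> simp [tau]
      obtain ⟨s, hs⟩ := hu
      rcases l with _ | ⟨y, l⟩
      · cases x <;> simp [tau] at h
      · obtain ⟨s', hs'⟩ := exists_flatMap_tau_append l
        refine ⟨l, ?_⟩
        rw [List.flatMap_cons, List.flatMap_cons, List.append_assoc, List.append_assoc, hs,
          hs'] at h
        rw [hs, hs']
        cases x <;> cases y <;> simp_all [tau]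
    obtain ⟨l', rfl, h'⟩ := key
    obtain ⟨l'', rfl, h''⟩ := ih h'
    exact ⟨l'', rfl, h''⟩

theorem exists_eq_cons_of_flatMap_tau {x : Letter} {l r : List Letter}
    (h : l.flatMap tau ++ [Letter.a] = tau x ++ Letter.a :: r) :
    ∃ l', l = x :: l' ∧ l'.flatMap tau ++ [Letter.a] = Letter.a :: r := by
  have h' : l.flatMap tau ++ [Letter.a] = [x].flatMap tau ++ Letter.a :: r := by simpa using h
  exact desubstitute_prefix h'

/-- The borders fix where images are cut, so the whole occurrence decodes. This is the inductive
step of `not_kernelWord_infix`. -/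
theorem bordered_infix_of_infix {x : Letter} {u l : List Letter}
    (h : nextLetter x :: (u.flatMap tau ++ [Letter.a]) ++ [nextLetter x] <:+:
      l.flatMap tau ++ [Letter.a]) : x :: u ++ [x] <:+: l := by
  obtain ⟨p, s, h⟩ := h
  by_cases hx : x = Letter.c
  · subst hx
    have h1 : l.flatMap tau ++ [Letter.a] =
        p ++ Letter.a :: (u.flatMap tau ++ Letter.a :: Letter.a :: s) := by
      rw [← h]; simp [nextLetter]
    obtain ⟨l₁, l₂, rfl, h2⟩ := desubstitute_of_a h1
    have h3 : l₂.flatMap tau ++ [Letter.a] =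
        (Letter.c :: u).flatMap tau ++ Letter.a :: (Letter.a :: s) := by
      rw [h2]; simp [tau]
    obtain ⟨l₃, rfl, h4⟩ := desubstitute_prefix h3
    obtain ⟨l₄, rfl, -⟩ := exists_eq_cons_of_flatMap_tau (x := Letter.c) (r := s) h4
    exact ⟨l₁, l₄, by simp⟩
  · have h1 : l.flatMap tau ++ [Letter.a] =
        p ++ nextLetter x :: (u.flatMap tau ++ Letter.a :: nextLetter x :: s) := by
      rw [← h]; simp
    obtain ⟨l₁, l₂, rfl, h2⟩ := desubstitute_of_nextLetter hx h1
    obtain ⟨l₃, rfl, h4⟩ := desubstitute_prefix h2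
    have h5 : l₃.flatMap tau ++ [Letter.a] = [Letter.a] ++ nextLetter x :: s := h4
    rcases l₃ with _ | ⟨y, l₃⟩
    · simp at h5
    · obtain ⟨r, hr⟩ := exists_flatMap_tau_append l₃
      rw [List.flatMap_cons, List.append_assoc, hr] at h5
      have : y = x := by cases x <;> cases y <;> simp_all [tau, nextLetter]
      subst this
      exact ⟨l₁, l₃, by simp⟩

/-- The first occurrence of `kernelWord m` is not inside `palPrefix (m + 3)`. -/
theorem not_kernelWord_infix (m : ℕ) : ¬ kernelWord m <:+: palPrefix (m + 3) := by
  induction m with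
  | zero =>
    change ¬ [Letter.a, Letter.a] <:+: [Letter.a, Letter.b, Letter.a, Letter.c, Letter.a, Letter.b,
      Letter.a]
    decide
  | succ m ih => exact fun h => ih (bordered_infix_of_infix h)

/-! ### Lengths -/

theorem length_flatMap_tau_twice (l : List Letter) :
    (((l.flatMap tau).flatMap tau).flatMap tau).length =
      ((l.flatMap tau).flatMap tau).length + (l.flatMap tau).length + l.length := by
  induction l with
  | nil => rfl
  | cons x l ih =>
    simp only [List.flatMap_cons, List.flatMap_append, List.length_append, List.length_cons, ih]
    cases x <;> simp [tau] <;> omega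

theorem length_T : ∀ m, (T m).length = t m
  | 0 => rfl
  | 1 => rfl
  | 2 => rfl
  | m + 3 => by
    rw [t, ← length_T m, ← length_T (m + 1), ← length_T (m + 2)]
    exact length_flatMap_tau_twice (T m)

theorem k_add_five (m : ℕ) : k (m + 5) = k (m + 4) + t m := by
  -- The recurrence has order three, so three consecutive identities are carried; the lower bounds
  -- prevent truncated subtraction.
  have key : ∀ m, (2 ≤ k (m + 4) ∧ 1 ≤ k (m + 3) ∧ 1 ≤ k (m + 2)) ∧ k (m + 5) = k (m + 4) + t m ∧
      k (m + 6) = k (m + 5) + t (m + 1) ∧ k (m + 7) = k (m + 6) + t (m + 2) := by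
    intro m
    induction m with
    | zero => decide
    | succ m ih =>
      obtain ⟨⟨h4, h3, h2⟩, e5, e6, e7⟩ := ih
      refine ⟨⟨?_, ?_, ?_⟩, e6, e7, ?_⟩
      · change 2 ≤ k (m + 5); omega
      · change 1 ≤ k (m + 4); omega
      · change 1 ≤ k (m + 3); omega
      · have a8 : k (m + 8) = k (m + 7) + k (m + 6) + k (m + 5) - 1 := rfl
        have a7 : k (m + 7) = k (m + 6) + k (m + 5) + k (m + 4) - 1 := rfl
        have at3 : t (m + 3) = t (m + 2) + t (m + 1) + t m := rfl
        change k (m + 8) = k (m + 7) + t (m + 3)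
        omega
  exact (key m).2.1

theorem length_palPrefix (m : ℕ) : (palPrefix m).length + 2 = k (m + 4) := by
  induction m with
  | zero => rfl
  | succ m ih =>
    rw [palPrefix_succ_eq_append, List.length_append, length_T, k_add_five, ← ih]
    omega

/-! ### Palindromes as reflections of positions -/

/-- The factor at the positions `i, …, n` is a palindrome. -/
def PalindromeAt (i n : ℕ) : Prop := ∀ j ≤ n, i ≤ j → word (i + n - j) = word j

instance (i n : ℕ) : Decidable (PalindromeAt i n) :=
  inferInstanceAs (Decidable (∀ j ≤ n, i ≤ j → word (i + n - j) = word j))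

theorem palindrome_factorAt_iff {i l n : ℕ} (h : i + l = n + 1) :
    (factorAt i l).Palindrome ↔ PalindromeAt i n := by
  rw [List.Palindrome.iff_reverse_eq]
  constructor
  · intro e j hj hij
    have e' := congrArg (fun w => w[j - i]?) e
    have hl : j - i < l := by omega
    simp only [factorAt] at e'
    rw [List.getElem?_reverse (by simpa using hl)] at e'
    simp [hl, show l - 1 - (j - i) < l by omega] at e'
    rwa [show i + (l - 1 - (j - i)) = i + n - j by omega,
      show i + (j - i) = j by omega] at e'
  · intro e
    apply List.ext_getElem <;> simp [factorAt]
    intro j hj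
    have := e (i + j) (by omega) (by omega)
    rw [← this]
    congr 1
    omega

/-- Once the end is fixed, the start determines both the word and its occurrence index. -/
theorem b_eq_card (n : ℕ) : b n = {i ∈ Finset.Icc 1 n | PalindromeAt i n}.card := by
  rw [b, ← Set.ncard_coe_finset]
  symm
  refine Set.ncard_congr (fun i _ => (factorAt i (n + 1 - i),
    {j : ℕ | j ≤ i ∧ OccursAt (factorAt i (n + 1 - i)) j}.ncard)) ?_ ?_ ?_
  · intro i hi
    simp only [Finset.coe_filter, Finset.mem_Icc, Set.mem_ofPred_eq] at hi
    obtain ⟨⟨h1, h2⟩, hp⟩ := hi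
    have ho : OccursAt (factorAt i (n + 1 - i)) i := ⟨h1, by rw [length_factorAt]⟩
    refine ⟨⟨?_, (palindrome_factorAt_iff (by omega)).2 hp, i, ho⟩, i, ⟨ho, rfl⟩, ?_⟩
    · apply List.ne_nil_of_length_pos
      rw [length_factorAt]
      omega
    · simp only [length_factorAt]
      omega
  · intro i j hi hj h
    simp only [Finset.coe_filter, Finset.mem_Icc, Set.mem_ofPred_eq] at hi hj
    have := congrArg (fun x => x.1.length) h
    simp only [length_factorAt] at this
    omega
  · rintro ⟨w, p⟩ ⟨⟨h0, hp, -⟩, i, ⟨ho, hn⟩, hl⟩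
    have hpos := List.length_pos_of_ne_nil h0
    simp only at h0 hp ho hn hl hpos
    have hw : factorAt i (n + 1 - i) = w := by rw [← hl, Nat.add_sub_cancel_left]; exact ho.2
    have h1 := ho.1
    refine ⟨i, ?_, ?_⟩
    · simp only [Finset.coe_filter, Finset.mem_Icc, Set.mem_ofPred_eq]
      refine ⟨⟨h1, by omega⟩, (palindrome_factorAt_iff hl).1 ?_⟩
      rwa [ho.2]
    · simp only [hw, hn]

theorem palindromeAt_palPrefix (m : ℕ) : PalindromeAt 1 (palPrefix m).length := by
  rw [← palindrome_factorAt_iff (Nat.add_comm 1 _), ← palPrefix_eq_factorAt,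
    List.Palindrome.iff_reverse_eq, reverse_palPrefix]

theorem word_add_t {m i : ℕ} (h1 : 1 ≤ i) (h2 : i ≤ (palPrefix m).length) :
    word (i + t m) = word i := by
  have e := eq_factorAt_of_append (u := T m) (v := palPrefix m) (w := []) (i := 1) (by
    rw [List.append_nil, ← palPrefix_succ_eq_append]
    exact palPrefix_eq_factorAt _)
  rw [length_T] at e
  have := word_eq_of_factorAt_eq (e.symm.trans (palPrefix_eq_factorAt m)) (l := i - 1) (by omega)
  rwa [show 1 + t m + (i - 1) = i + t m by omega, show 1 + (i - 1) = i by omega] at this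

theorem kernelWord_eq_factorAt (m : ℕ) :
    kernelWord m = factorAt (t (m + 3)) ((palPrefix m).length + 2) := by
  obtain ⟨u, v, hT, hU⟩ := exists_kernelWord_decomposition m
  have e := eq_factorAt_of_append (i := 1) (hU ▸ palPrefix_eq_factorAt (m + 4))
  have hl := congrArg List.length hT
  rw [length_T, List.length_append, List.length_singleton] at hl
  rw [hl, Nat.add_comm u.length 1]
  have hk : (kernelWord m).length = (palPrefix m).length + 2 := by simp [kernelWord]
  rwa [hk] at e

theorem length_palPrefix_add_three (m : ℕ) :
    (palPrefix (m + 3)).length = t (m + 3) + (palPrefix m).length := by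
  simp only [palPrefix_succ_eq_append, List.length_append, length_T]
  rw [t]
  omega

theorem not_shifted_kernelWord {m p : ℕ} (hp : 0 < p) (hpt : p < t (m + 3)) :
    ¬ ∀ j ≤ (palPrefix (m + 3)).length + 1, t (m + 3) ≤ j → word (j - p) = word j := by
  intro h
  have hl := length_palPrefix_add_three m
  refine not_kernelWord_infix m ?_
  have e : kernelWord m = factorAt (t (m + 3) - p) ((palPrefix m).length + 2) := by
    rw [kernelWord_eq_factorAt]
    refine factorAt_congr fun l hlt => ?_
    rw [← h _ (by omega) (by omega)]
    congr 1
    omega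
  rw [e, palPrefix_eq_factorAt (m + 3)]
  exact factorAt_infix (by omega) (by omega)

theorem palindromeAt_start_unique {m i n : ℕ} (hi1 : 1 ≤ i) (hit : i ≤ t (m + 3))
    (hn1 : (palPrefix (m + 3)).length < n) (hn2 : n ≤ (palPrefix (m + 4)).length)
    (h : PalindromeAt i n) : i + n = (palPrefix (m + 4)).length + 1 := by
  have hL : (palPrefix (m + 4)).length = t (m + 3) + (palPrefix (m + 3)).length := by
    rw [palPrefix_succ_eq_append, List.length_append, length_T]
  have hP := palindromeAt_palPrefix (m + 4)
  have hl := length_palPrefix_add_three m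
  rw [hL] at hP hn2 ⊢
  -- Off centre, the two reflections are composed in the order that moves the window to the left.
  rcases lt_trichotomy (i + n) (t (m + 3) + (palPrefix (m + 3)).length + 1) with hlt | heq | hgt
  · exfalso
    refine not_shifted_kernelWord (m := m)
      (p := t (m + 3) + (palPrefix (m + 3)).length + 1 - (i + n)) (by omega) (by omega) ?_
    intro j hj1 hj2
    rw [← hP j (by omega) (by omega), ← h (1 + (t (m + 3) + (palPrefix (m + 3)).length) - j)
      (by omega) (by omega)]
    congr 1
    omega
  · exact heq
  · exfalso
    refine not_shifted_kernelWord (m := m)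
      (p := i + n - (t (m + 3) + (palPrefix (m + 3)).length + 1)) (by omega) (by omega) ?_
    intro j hj1 hj2
    rw [← h j (by omega) (by omega), ← hP (i + n - j) (by omega) (by omega)]
    congr 1
    omega

theorem palindromeAt_of_add_eq {m i n : ℕ} (hi : 1 ≤ i) (h : i + n = (palPrefix m).length + 1) :
    PalindromeAt i n := by
  intro j hj hij
  rw [← palindromeAt_palPrefix m j (by omega) (by omega)]
  congr 1
  omega

theorem palindromeAt_add_t {m i n : ℕ} (hi : 1 ≤ i) (hn : n ≤ (palPrefix m).length) :
    PalindromeAt (i + t m) (n + t m) ↔ PalindromeAt i n := by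
  have shift : ∀ j ≤ n, i ≤ j → (word (i + t m + (n + t m) - (j + t m)) = word (j + t m) ↔
      word (i + n - j) = word j) := by
    intro j hj hij
    rw [show i + t m + (n + t m) - (j + t m) = i + n - j + t m by omega,
      word_add_t (by omega) (by omega), word_add_t (by omega) (by omega)]
  constructor
  · exact fun h j hj hij => (shift j hj hij).1 (h _ (by omega) (by omega))
  · intro h j hj hij
    have := (shift (j - t m) (by omega) (by omega)).2 (h _ (by omega) (by omega))
    rwa [show j - t m + t m = j by omega] at this

theorem b_add_t {m n : ℕ} (hn1 : (palPrefix (m + 3)).length < n + t (m + 3))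
    (hn2 : n ≤ (palPrefix (m + 3)).length) : b (n + t (m + 3)) = b n + 1 := by
  have hL : (palPrefix (m + 4)).length = t (m + 3) + (palPrefix (m + 3)).length := by
    rw [palPrefix_succ_eq_append, List.length_append, length_T]
  rw [b_eq_card, b_eq_card]
  -- The inserted start mirrors the end `n + t (m + 3)` in U_{m+4}.
  have e : {i ∈ Finset.Icc 1 (n + t (m + 3)) | PalindromeAt i (n + t (m + 3))} =
      insert ((palPrefix (m + 3)).length + 1 - n)
        ({i ∈ Finset.Icc 1 n | PalindromeAt i n}.map (addRightEmbedding (t (m + 3)))) := by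
    ext i
    simp only [Finset.mem_filter, Finset.mem_Icc, Finset.mem_insert, Finset.mem_map,
      addRightEmbedding_apply]
    constructor
    · rintro ⟨⟨h1, h2⟩, hp⟩
      rcases Nat.lt_or_ge (t (m + 3)) i with hi | hi
      · refine Or.inr ⟨i - t (m + 3), ⟨⟨by omega, by omega⟩, ?_⟩, by omega⟩
        rw [← palindromeAt_add_t (m := m + 3) (by omega) hn2, Nat.sub_add_cancel hi.le]
        exact hp
      · have := palindromeAt_start_unique h1 hi hn1 (by omega) hp
        omega
    · rintro (rfl | ⟨i', ⟨⟨h1, h2⟩, hp⟩, rfl⟩)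
      · exact ⟨⟨by omega, by have := length_palPrefix_add_three m; omega⟩,
          palindromeAt_of_add_eq (m := m + 4) (by omega) (by omega)⟩
      · exact ⟨⟨by omega, by omega⟩, (palindromeAt_add_t h1 hn2).2 hp⟩
  rw [e, Finset.card_insert_of_notMem, Finset.card_map]
  simp only [Finset.mem_map, Finset.mem_filter, Finset.mem_Icc, addRightEmbedding_apply, not_exists]
  omega

/-! ### Blocks of values -/

theorem block_append {i j l : ℕ} (hi : 1 ≤ i) (hij : i ≤ j) (hjl : j ≤ l) :
    block i (j - 1) ++ block j (l - 1) = block i (l - 1) := by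
  rw [block, block, block, ← List.map_append]
  have := List.range'_append (s := i) (m := j - i) (n := l - j) (step := 1)
  rw [one_mul, show i + (j - i) = j by omega] at this
  rw [show j - 1 + 1 - i = j - i by omega, show l - 1 + 1 - j = l - j by omega, this,
    show l - 1 + 1 - i = j - i + (l - j) by omega]

theorem block_add {i j d : ℕ} (h : ∀ n, i ≤ n → n ≤ j → b (n + d) = b n + 1) :
    block (i + d) (j + d) = (block i j).map (· + 1) := by
  rw [block, block, List.map_map, show j + d + 1 - (i + d) = j + 1 - i by omega]
  apply List.ext_getElem <;> simp
  intro l hl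
  rw [← h _ (by omega) (by omega)]
  congr 1
  omega

theorem block_one_seven : block 1 7 = [1, 1, 2, 1, 2, 2, 3] := by
  simp only [block, List.range', List.map, b_eq_card]
  decide +kernel

end Tribonacci

theorem mainTheorem4 :
    Tribonacci.block 1 1 = [1] ∧
    Tribonacci.block 2 3 = [1, 2] ∧
    Tribonacci.block 4 7 = [1, 2, 2, 3] ∧
    ∀ m : ℕ, 4 ≤ m →
      (Tribonacci.block (Tribonacci.k m - 1) (Tribonacci.k (m + 1) - 2) ++
        Tribonacci.block (Tribonacci.k (m + 1) - 1) (Tribonacci.k (m + 2) - 2) ++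
        Tribonacci.block (Tribonacci.k (m + 2) - 1) (Tribonacci.k (m + 3) - 2)).length =
          Tribonacci.t (m - 1) ∧
      Tribonacci.block (Tribonacci.k (m + 3) - 1) (Tribonacci.k (m + 4) - 2) =
        (Tribonacci.block (Tribonacci.k m - 1) (Tribonacci.k (m + 1) - 2) ++
          Tribonacci.block (Tribonacci.k (m + 1) - 1) (Tribonacci.k (m + 2) - 2) ++
          Tribonacci.block (Tribonacci.k (m + 2) - 1) (Tribonacci.k (m + 3) - 2)).map (· + 1) := by
  open Tribonacci in
  refine ⟨congrArg (List.take 1) block_one_seven,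
    congrArg (fun l => (l.drop 1).take 2) block_one_seven,
    congrArg (List.drop 3) block_one_seven, ?_⟩
  intro m hm
  obtain ⟨m, rfl⟩ : ∃ j, m = j + 4 := ⟨m - 4, by omega⟩
  have l0 := length_palPrefix m
  have l3 := length_palPrefix (m + 3)
  have e0 := k_add_five m
  have e1 := k_add_five (m + 1)
  have e2 := k_add_five (m + 2)
  have e3 := k_add_five (m + 3)
  have et : t (m + 3) = t (m + 2) + t (m + 1) + t m := rfl
  simp only [Nat.add_assoc, Nat.reduceAdd] at l0 l3 e0 e1 e2 e3 ⊢
  have hb := block_append (i := k (m + 4) - 1) (j := k (m + 5) - 1) (l := k (m + 6) - 1)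
    (by omega) (by omega) (by omega)
  have hb' := block_append (i := k (m + 4) - 1) (j := k (m + 6) - 1) (l := k (m + 7) - 1)
    (by omega) (by omega) (by omega)
  simp only [Nat.sub_sub, Nat.reduceAdd] at hb hb'
  rw [hb, hb']
  refine ⟨?_, ?_⟩
  · simp only [block, List.length_map, List.length_range', show m + 4 - 1 = m + 3 from rfl]
    omega
  · rw [← block_add (d := t (m + 3)) fun n h1 h2 => b_add_t (by omega) (by omega)]
    congr 1 <;> omega
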